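/- Let $k,d,q\ge 2$ be integers. There is a function $o:\mathbb N\to\mathbb R$, depending only on $k,d,q$, with $o(n)\to 0$ as $n\to\infty$, such that every finite $k$-uniform hypergraph $H$ with $n$ vertices and skeletal degeneracy $d$ satisfies $$r(H;q)\le n^{1+o(n)}$$ (in particular, $r(H;q)$ exists). Here the degeneracy of a finite hypergraph is the least integer $m\ge 0$ such that each of its subhypergraphs with at least one vertex has a vertex of degree at most $m$. The skeletal degeneracy of $H$ is the degeneracy of its $1$-skeleton, which is the graph on the vertex set of $H$ whose edges are the pairs of distinct vertices contained in a common edge of $H$. The $q$-color Ramsey number $r(H;q)$ is the least positive integer $N$ such that every coloring of the edges of the complete $k$-uniform hypergraph on $N$ vertices with $q$ colors contains a monochromatic copy of $H$. -/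

import Mathlib

open Filter Topology
open scoped Hypergraph

namespace Hypergraph

universe u v

/-- `H` is `k`-uniform if every edge has exactly `k` vertices (used with `k` positive,
where `ncard` equal to `k` forces the edge to be finite). -/
def IsUniform {α : Type u} (H : Hypergraph α) (k : ℕ) : Prop :=
  ∀ e ∈ E(H), e.ncard = k

/-- `H'` is a subhypergraph of `H`, not necessarily induced or spanning. -/
def IsSubhypergraph {α : Type u} (H' H : Hypergraph α) : Prop :=
  V(H') ⊆ V(H) ∧ E(H') ⊆ E(H)

/-- The degree of `v`: the number of edges containing it (for finite hypergraphs). -/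
noncomputable def degree {α : Type u} (H : Hypergraph α) (v : α) : ℕ :=
  {e | e ∈ E(H) ∧ v ∈ e}.ncard

/-- The degeneracy of a finite hypergraph: the least `d` such that every subhypergraph with at
least one vertex has minimum degree at most `d`. -/
noncomputable def degeneracy {α : Type u} (H : Hypergraph α) : ℕ :=
  sInf {d : ℕ | ∀ H' : Hypergraph α, H'.IsSubhypergraph H → V(H').Nonempty →
    ∃ v ∈ V(H'), H'.degree v ≤ d}

/-- The `i`-skeleton: the `(i + 1)`-uniform hypergraph on the same vertex set whose edges are the
`(i + 1)`-element sets contained in some edge of `H`. -/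
def skeleton {α : Type u} (H : Hypergraph α) (i : ℕ) : Hypergraph α where
  vertexSet := V(H)
  edgeSet := {f | f.ncard = i + 1 ∧ ∃ e ∈ E(H), f ⊆ e}
  subset_vertexSet_of_mem_edgeSet' := by
    rintro f ⟨-, e, he, hfe⟩
    exact hfe.trans (H.subset_vertexSet_of_mem_edgeSet' he)

/-- The skeletal degeneracy: the degeneracy of the `1`-skeleton. -/
noncomputable def skeletalDegeneracy {α : Type u} (H : Hypergraph α) : ℕ :=
  (H.skeleton 1).degeneracy

/-- The complete `k`-uniform hypergraph on `N` vertices. -/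
def completeUniform (N k : ℕ) : Hypergraph (Fin N) where
  vertexSet := Set.univ
  edgeSet := {e | e.ncard = k}
  subset_vertexSet_of_mem_edgeSet' := fun _ _ => Set.subset_univ _

/-- `G` contains a copy of `H`: there is a map that is injective on the vertices of `H` and
carries vertices to vertices and edges to edges. -/
def ContainsCopy {α : Type u} {β : Type v} (G : Hypergraph β) (H : Hypergraph α) : Prop :=
  ∃ φ : α → β, Set.InjOn φ V(H) ∧ Set.MapsTo φ V(H) V(G) ∧ ∀ e ∈ E(H), φ '' e ∈ E(G)

/-- The hypergraph formed by the edges of color `i` in a coloring of the edges of the complete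
`k`-uniform hypergraph on `N` vertices. -/
def colorClass {N k q : ℕ} (c : E(completeUniform N k) → Fin q) (i : Fin q) :
    Hypergraph (Fin N) where
  vertexSet := Set.univ
  edgeSet := {e | ∃ he : e ∈ E(completeUniform N k), c ⟨e, he⟩ = i}
  subset_vertexSet_of_mem_edgeSet' := fun _ _ => Set.subset_univ _

/-- Every coloring of the edges of the complete `k`-uniform hypergraph on `N` vertices with `q`
colors contains a monochromatic copy of `H`. -/
def IsRamsey {α : Type u} (H : Hypergraph α) (k q N : ℕ) : Prop :=
  ∀ c : E(completeUniform N k) → Fin q, ∃ i : Fin q, (colorClass c i).ContainsCopy H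

/-- The `q`-color Ramsey number of a `k`-uniform hypergraph `H`: the least positive `N` such that
every `q`-coloring of the complete `k`-uniform hypergraph on `N` vertices contains a monochromatic
copy of `H`. -/
noncomputable def ramseyNumber {α : Type u} (H : Hypergraph α) (k q : ℕ) : ℕ :=
  sInf {N : ℕ | 0 < N ∧ H.IsRamsey k q N}

end Hypergraph

/-! Fix a block size `t` and let `R` be the Ramsey number of a clique on `(d + 1) * t` vertices, a
constant. Choose `R` of the `N` vertices at random. A monochromatic clique among them splits into `d
+ 1` blocks of size `t`, one for each class of a proper colouring of the skeleton of `H`. Embed `H`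
greedily along a degeneracy order, letting each block stand for the vertices of its class not yet
embedded. The candidates for the next vertex depend on at most `d` embedded neighbours and on the
other blocks, and they contain the vertex's own block. A random block falls into a fixed set of
fewer than `n` vertices with probability at most `(n / N) ^ t`, and there are `O(N ^ d)` such sets.
So if `N ^ t` exceeds a constant times `n ^ t * N ^ d`, every candidate set met has at least `n`
elements and the embedding never stops. Large `t` gives `N = n ^ (1 + ε)`. The counting is
`exists_injective_hasLargeExtensions`, the embedding `IsSkeletallyDegenerate.exists_embedding`. -/

namespace Finset

/-! ### Ramsey's theorem for uniform hypergraphs -/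

/-- If colourings of the `k`-subsets have large monochromatic sets, then colourings of the
`(k + 1)`-subsets have large sets on which the colour only depends on the smallest element. -/
theorem exists_endHomogeneous_of_ramsey (q k : ℕ)
    (ih : ∀ s, ∃ R, ∀ Y : Finset ℕ, R ≤ #Y → ∀ c : Finset ℕ → Fin q,
      ∃ X ⊆ Y, #X = s ∧ ∃ i, ∀ e ⊆ X, #e = k → c e = i) (m : ℕ) :
    ∃ M, ∀ Y : Finset ℕ, M ≤ #Y → ∀ c : Finset ℕ → Fin q,
      ∃ Z ⊆ Y, #Z = m ∧ ∃ g : ℕ → Fin q, ∀ z ∈ Z, ∀ e ⊆ Z, #e = k → (∀ y ∈ e, z < y) →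
        c (insert z e) = g z := by
  induction m with
  | zero =>
    exact ⟨0, fun Y _ c => ⟨∅, by simp, by simp, fun _ => c ∅, by simp⟩⟩
  | succ m ihm =>
    obtain ⟨M, hM⟩ := ihm
    obtain ⟨R, hR⟩ := ih M
    refine ⟨R + 1, fun Y hY c => ?_⟩
    have hne : Y.Nonempty := card_pos.mp (by omega)
    set z := Y.min' hne with hz
    have hzY : z ∈ Y := Y.min'_mem hne
    -- Apply Ramsey for `k`-sets to the link of the smallest vertex, then recurse inside the
    -- monochromatic set.
    obtain ⟨X, hXY, hX, i, hi⟩ := hR (Y.erase z) (by rw [card_erase_of_mem hzY]; omega)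
      (fun e => c (insert z e))
    obtain ⟨Z, hZX, hZ, g, hg⟩ := hM X hX.ge c
    have hlt : ∀ y ∈ Z, z < y := fun y hy => by
      have h := mem_erase.mp (hXY (hZX hy))
      exact lt_of_le_of_ne (Y.min'_le y h.2) (Ne.symm h.1)
    have hzZ : z ∉ Z := fun h => lt_irrefl _ (hlt z h)
    refine ⟨insert z Z, ?_, by rw [card_insert_of_notMem hzZ, hZ], Function.update g z i, ?_⟩
    · exact insert_subset hzY ((hZX.trans hXY).trans (erase_subset _ _))
    · intro y hy e he hek hye
      have heZ : e ⊆ Z := fun x hx => by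
        rcases mem_insert.mp (he hx) with rfl | h
        · rcases mem_insert.mp hy with h | h
          · exact absurd (hye _ hx) (by simp [h])
          · exact absurd (hye _ hx) (hlt y h).asymm
        · exact h
      rcases mem_insert.mp hy with rfl | h
      · rw [Function.update_self]
        exact hi e (heZ.trans hZX) hek
      · rw [Function.update_of_ne (hlt y h).ne']
        exact hg y h e heZ hek hye

/-- Ramsey's theorem for `k`-uniform hypergraphs and `q` colours. -/
theorem exists_ramsey (q k s : ℕ) :
    ∃ R, ∀ Y : Finset ℕ, R ≤ #Y → ∀ c : Finset ℕ → Fin q,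
      ∃ X ⊆ Y, #X = s ∧ ∃ i, ∀ e ⊆ X, #e = k → c e = i := by
  induction k generalizing s with
  | zero =>
    refine ⟨s, fun Y hY c => ?_⟩
    obtain ⟨X, hX, hs⟩ := exists_subset_card_eq hY
    refine ⟨X, hX, hs, c ∅, fun e _ h => ?_⟩
    rw [card_eq_zero.mp h]
  | succ k ih =>
    obtain ⟨M, hM⟩ := exists_endHomogeneous_of_ramsey q k ih (q * s)
    refine ⟨M, fun Y hY c => ?_⟩
    obtain ⟨Z, hZY, hZ, g, hg⟩ := hM Y hY c
    have : Nonempty (Fin q) := ⟨c ∅⟩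
    obtain ⟨i, -, hi⟩ := exists_le_card_fiber_of_mul_le_card_of_maps_to
      (s := Z) (t := univ) (f := g) (n := s) (fun _ _ => mem_univ _) univ_nonempty
      (by simp [hZ])
    obtain ⟨X, hX, hs⟩ := exists_subset_card_eq hi
    refine ⟨X, fun x hx => hZY (mem_filter.mp (hX hx)).1, hs, i, fun e he hek => ?_⟩
    have hne : e.Nonempty := card_pos.mp (by omega)
    have hmem := e.min'_mem hne
    rw [← insert_erase hmem]
    have hz := mem_filter.mp (hX (he hmem))
    rw [hg _ hz.1 (e.erase (e.min' hne)) _ (by rw [card_erase_of_mem hmem]; omega) _, hz.2]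
    · exact fun x hx => (mem_filter.mp (hX (he (mem_of_mem_erase hx)))).1
    · exact fun y hy => e.min'_lt_of_mem_erase_min' hne hy

/-! ### Counting bad functions -/

/-- Functions taking a block of coordinates into a set of at most `n` values that is determined by
the other coordinates. -/
theorem card_filter_forall_mem_le {ρ β : Type*} [Fintype ρ] [DecidableEq ρ] [Fintype β]
    [DecidableEq β] (P : Finset ρ) (W : (ρ → β) → Finset β) (n : ℕ)
    (hW : ∀ f f', (∀ p ∉ P, f p = f' p) → W f = W f') (hn : ∀ f, #(W f) ≤ n) :
    #{f : ρ → β | ∀ p ∈ P, f p ∈ W f} ≤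
      n ^ #P * Fintype.card β ^ (Fintype.card ρ - #P) := by
  refine (card_le_mul_card_image (f := fun f (p : {p // p ∉ P}) => f p) _ (n ^ #P) ?_).trans ?_
  · intro a ha
    obtain ⟨f₀, -, rfl⟩ := mem_image.mp ha
    calc _ ≤ #(Fintype.piFinset fun _ : P => W f₀) := by
          refine card_le_card_of_injOn (fun f (p : P) => f p) ?_ ?_
          · intro f hf
            simp only [coe_filter, mem_filter, mem_univ, true_and, Set.mem_ofPred_eq] at hf
            rw [mem_coe, Fintype.mem_piFinset]
            intro p
            rw [← hW f f₀ fun p hp => congrFun hf.2 ⟨p, hp⟩]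
            exact hf.1 p p.2
          · intro f hf f' hf' h
            simp only [coe_filter, mem_filter, mem_univ, true_and, Set.mem_ofPred_eq] at hf hf'
            funext p
            by_cases hp : p ∈ P
            · exact congrFun h ⟨p, hp⟩
            · exact congrFun (hf.2.trans hf'.2.symm) ⟨p, hp⟩
      _ ≤ n ^ #P := by
          rw [Fintype.card_piFinset]
          simpa using Nat.pow_le_pow_left (hn f₀) #P
  · refine Nat.mul_le_mul_left _ ((card_le_univ _).trans ?_)
    rw [Fintype.card_fun, Fintype.card_subtype_compl, Fintype.card_coe]

theorem card_filter_not_injective_le (R N : ℕ) :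
    #{f : Fin R → Fin N | ¬ Function.Injective f} ≤ R ^ 2 * N ^ (R - 1) := by
  have hsub : ({f : Fin R → Fin N | ¬ Function.Injective f} : Finset (Fin R → Fin N)) ⊆
      ({p : Fin R × Fin R | p.1 ≠ p.2} : Finset (Fin R × Fin R)).biUnion
        fun p => {f : Fin R → Fin N |
          ∀ x ∈ ({p.2} : Finset (Fin R)), f x ∈ ({f p.1} : Finset (Fin N))} := by
    intro f hf
    simp only [mem_filter, mem_univ, true_and, Function.Injective, not_forall] at hf
    obtain ⟨a, b, hab, hne⟩ := hf
    simp only [mem_biUnion, mem_filter, mem_univ, true_and, mem_singleton]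
    exact ⟨(a, b), hne, fun x hx => by rw [hx, hab]⟩
  refine (card_le_card hsub).trans ((card_biUnion_le_card_mul _ _ (N ^ (R - 1)) ?_).trans
    (Nat.mul_le_mul_right _ ((card_le_univ _).trans (by simp [sq]))))
  intro p hp
  have hne : p.1 ≠ p.2 := (mem_filter.mp hp).2
  have hcard := card_filter_forall_mem_le (ρ := Fin R) (β := Fin N) {p.2} (fun f => {f p.1}) 1
    (fun f f' h => by rw [h p.1 (by simpa using hne)]) (by simp)
  simpa using hcard

end Finset

/-! ### Random choice of points with large extension sets -/

namespace Hypergraph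

/-- The vertices `w` that complete to an edge of `G` each pattern in `F`. A pattern is a set of
indices of the points `S` and of the blocks `τ j`, and every choice of one point from each of its
blocks has to be completed. -/
def extensionSet {β : Type*} {d l t : ℕ} (G : Set (Set β)) (τ : Fin l → Fin t → β)
    (S : Fin d → β) (F : Set (Set (Fin d ⊕ Fin l))) : Set β :=
  {w | ∀ A ∈ F, ∀ a : Fin l → Fin t, insert w (Sum.elim S (fun j => τ j (a j)) '' A) ∈ G}

theorem extensionSet_congr {β : Type*} {d l t : ℕ} (G : Set (Set β)) {τ τ' : Fin l → Fin t → β}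
    (S : Fin d → β) {F : Set (Set (Fin d ⊕ Fin l))} {j : Fin l} (hF : ∀ A ∈ F, Sum.inr j ∉ A)
    (h : ∀ i ≠ j, τ i = τ' i) : extensionSet G τ S F = extensionSet G τ' S F := by
  have key : ∀ A ∈ F, ∀ a : Fin l → Fin t,
      Sum.elim S (fun j => τ j (a j)) '' A = Sum.elim S (fun j => τ' j (a j)) '' A := by
    intro A hA a
    refine Set.image_congr ?_
    rintro (x | i) hx
    · rfl
    · have : i ≠ j := by rintro rfl; exact hF A hA hx
      simp [h i this]
  ext w
  simp only [extensionSet, Set.mem_ofPred_eq]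
  exact forall₂_congr fun A hA => forall_congr' fun a => by rw [key A hA a]

/-- Every extension set containing the block it is allowed to avoid has at least `n` elements. -/
def HasLargeExtensions {β : Type*} {l t : ℕ} (G : Set (Set β)) (d n : ℕ)
    (τ : Fin l → Fin t → β) : Prop :=
  ∀ (j : Fin l) (S : Fin d → β) (F : Set (Set (Fin d ⊕ Fin l))), (∀ A ∈ F, Sum.inr j ∉ A) →
    (∀ b, τ j b ∈ extensionSet G τ S F) → n ≤ (extensionSet G τ S F).ncard

-- Union bound over non-injective `f` and over all blocks, patterns and `d`-tuples `S`: by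
-- `extensionSet_congr` the extension set ignores block `j`, so once it is small, the `t`
-- coordinates of that block have at most `n ^ t` values.
open Finset in
open scoped Classical in
theorem exists_injective_hasLargeExtensions {q N R l t d n : ℕ} (G : Fin q → Set (Set (Fin N)))
    (h : R ^ 2 * N ^ (R - 1) +
      Fintype.card ((Fin l × Fin t ↪ Fin R) × Fin q × Fin l × Set (Set (Fin d ⊕ Fin l))) * N ^ d *
        (n ^ t * N ^ (R - t)) < N ^ R) :
    ∃ f : Fin R → Fin N, Function.Injective f ∧ ∀ (g : Fin l × Fin t ↪ Fin R) (i : Fin q),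
      HasLargeExtensions (G i) d n fun j b => f (g (j, b)) := by
  set I := (Fin l × Fin t ↪ Fin R) × Fin q × Fin l × Set (Set (Fin d ⊕ Fin l))
  let E : I × (Fin d → Fin N) → (Fin R → Fin N) → Set (Fin N) := fun x f =>
    extensionSet (G x.1.2.1) (fun j b => f (x.1.1 (j, b))) x.2 x.1.2.2.2
  -- The value `∅` when the set is large or depends on block `j` makes both hypotheses of the count
  -- hold for every index.
  let W : I × (Fin d → Fin N) → (Fin R → Fin N) → Finset (Fin N) := fun x f =>
    if (E x f).ncard < n ∧ ∀ A ∈ x.1.2.2.2, Sum.inr x.1.2.2.1 ∉ A then (E x f).toFinset else ∅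
  let P : I × (Fin d → Fin N) → Finset (Fin R) := fun x =>
    univ.image fun b => x.1.1 (x.1.2.2.1, b)
  let bad : I × (Fin d → Fin N) → Finset (Fin R → Fin N) := fun x =>
    {f | (∀ p ∈ P x, f p ∈ W x f)}
  have hPt : ∀ x, #(P x) = t := fun x => by
    rw [card_image_of_injective _ fun b b' hb => by simpa using x.1.1.injective hb]
    simp
  have hbad : ∀ x, #(bad x) ≤ n ^ t * N ^ (R - t) := by
    intro x
    have hcard := card_filter_forall_mem_le (P x) (W x) n ?_ ?_
    · rw [hPt, Fintype.card_fin, Fintype.card_fin] at hcard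
      convert hcard
    · intro f f' hff
      by_cases hx : ∀ A ∈ x.1.2.2.2, Sum.inr x.1.2.2.1 ∉ A
      · have : E x f = E x f' := by
          refine extensionSet_congr _ _ hx fun i hi => funext fun b => hff _ ?_
          simp only [P, mem_image, mem_univ, true_and, not_exists]
          intro b' hb'
          exact hi (congrArg Prod.fst (x.1.1.injective hb')).symm
        simp only [W, this]
      · simp only [W, hx, and_false, if_false]
    · intro f
      simp only [W]
      split_ifs with hx
      · rw [← Set.ncard_eq_toFinset_card']
        exact hx.1.le
      · simp
  have hlt : #(({f : Fin R → Fin N | ¬ Function.Injective f} : Finset (Fin R → Fin N)) ∪ univ.biUnion bad) <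
      #(univ : Finset (Fin R → Fin N)) := by
    refine (card_union_le _ _).trans_lt (lt_of_le_of_lt (add_le_add
      (card_filter_not_injective_le R N)
      (card_biUnion_le_card_mul _ _ _ fun x _ => hbad x)) ?_)
    rw [card_univ, card_univ, Fintype.card_prod I, Fintype.card_fun, Fintype.card_fun]
    simpa only [Fintype.card_fin] using h
  obtain ⟨f, -, hf⟩ := exists_mem_notMem_of_card_lt_card hlt
  simp only [mem_union, mem_filter, mem_univ, true_and, mem_biUnion, not_or, not_not,
    not_exists] at hf
  refine ⟨f, hf.1, fun g i j S F hF hτ => ?_⟩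
  by_contra hcon
  refine hf.2 ((g, i, j, F), S) ?_
  simp only [bad, mem_filter, mem_univ, true_and, P, mem_image, forall_exists_index,
    forall_apply_eq_imp_iff]
  intro b
  have : (E ((g, i, j, F), S) f).ncard < n ∧ ∀ A ∈ F, Sum.inr j ∉ A := ⟨not_le.mp hcon, hF⟩
  simp only [W]
  rw [if_pos this, Set.mem_toFinset]
  exact hτ b

end Hypergraph

/-! ### Degeneracy orders, colouring and greedy embedding -/

namespace Hypergraph

/-- Every nonempty set of vertices has a member with at most `d` neighbours in the set. -/
def IsSkeletallyDegenerate {α : Type*} (H : Hypergraph α) (d : ℕ) : Prop :=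
  ∀ X ⊆ V(H), X.Nonempty → ∃ v ∈ X, {u | u ∈ X ∧ u ≠ v ∧ H.Adj u v}.ncard ≤ d

theorem isSkeletallyDegenerate_skeletalDegeneracy {α : Type*} {H : Hypergraph α}
    (hfin : V(H).Finite) (hpos : 0 < H.skeletalDegeneracy) :
    H.IsSkeletallyDegenerate H.skeletalDegeneracy := by
  intro X hX hne
  -- Positivity rules out the junk value `sInf ∅ = 0`, so the infimum is attained.
  have hmem := Nat.sInf_mem (Nat.nonempty_of_pos_sInf hpos)
  obtain ⟨v, hv, hdeg⟩ := hmem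
    { vertexSet := X
      edgeSet := {f | f ∈ E(H.skeleton 1) ∧ f ⊆ X}
      subset_vertexSet_of_mem_edgeSet' := fun f hf => hf.2 } ⟨hX, fun f hf => hf.1⟩ hne
  refine ⟨v, hv, le_trans ?_ hdeg⟩
  refine Set.ncard_le_ncard_of_injOn (fun u => {u, v}) ?_ ?_ ?_
  · rintro u ⟨hu, huv, e, he, hue, hve⟩
    refine ⟨⟨⟨Set.ncard_pair huv, e, he, ?_⟩, ?_⟩, by simp⟩
    · exact Set.pair_subset hue hve
    · exact Set.pair_subset hu hv
  · rintro u ⟨-, huv, -⟩ u' - h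
    have : u ∈ ({u', v} : Set α) := by rw [← show ({u, v} : Set α) = {u', v} from h]; simp
    simpa [huv] using this
  · exact (hfin.subset hX).finite_subsets.subset fun f hf => hf.1.2

theorem two_le_ncard_of_skeletalDegeneracy_pos {α : Type*} {H : Hypergraph α}
    (hfin : V(H).Finite) (hpos : 0 < H.skeletalDegeneracy) : 2 ≤ V(H).ncard := by
  by_contra hlt
  refine hpos.ne' (Nat.sInf_eq_zero.mpr (Or.inl fun H' hH' hne => ?_))
  obtain ⟨v, hv⟩ := hne
  refine ⟨v, hv, ?_⟩
  rw [degree, show {e | e ∈ E(H') ∧ v ∈ e} = ∅ from ?_, Set.ncard_empty]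
  refine Set.eq_empty_of_forall_notMem fun f hf => hlt ?_
  have hf' := hH'.2 hf.1
  rw [← show f.ncard = 2 from hf'.1]
  exact Set.ncard_le_ncard (hf'.subset_vertexSet) hfin

theorem IsSkeletallyDegenerate.induction {α : Type*} {H : Hypergraph α} {d : ℕ}
    (hdeg : H.IsSkeletallyDegenerate d) (hfin : V(H).Finite) {P : Set α → Prop} (empty : P ∅)
    (step : ∀ X ⊆ V(H), ∀ v ∈ X, {u | u ∈ X ∧ u ≠ v ∧ H.Adj u v}.ncard ≤ d → P (X \ {v}) → P X) :
    P V(H) := by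
  suffices h : ∀ m, ∀ X ⊆ V(H), X.ncard = m → P X from h _ _ subset_rfl rfl
  intro m
  induction m with
  | zero =>
    intro X hX h
    rwa [(Set.ncard_eq_zero (hfin.subset hX)).mp h]
  | succ m ih =>
    intro X hX h
    obtain ⟨v, hv, hd⟩ := hdeg X hX (Set.nonempty_of_ncard_ne_zero (by omega))
    refine step X hX v hv hd (ih _ (Set.sdiff_subset.trans hX) ?_)
    rw [Set.ncard_sdiff_singleton_of_mem hv, h, Nat.add_sub_cancel]

/-- Each edge of `H` is a clique of the skeleton, so a greedy proper colouring of the skeleton is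
injective on edges. -/
theorem IsSkeletallyDegenerate.exists_coloring {α : Type*} {H : Hypergraph α} {d : ℕ}
    (hdeg : H.IsSkeletallyDegenerate d) (hfin : V(H).Finite) :
    ∃ χ : α → Fin (d + 1), ∀ e ∈ E(H), Set.InjOn χ e := by
  classical
  have key : ∃ χ : α → Fin (d + 1), ∀ u ∈ V(H), ∀ v ∈ V(H), u ≠ v → H.Adj u v → χ u ≠ χ v := by
    refine hdeg.induction (P := fun X => ∃ χ : α → Fin (d + 1), ∀ u ∈ X, ∀ v ∈ X, u ≠ v →
      H.Adj u v → χ u ≠ χ v) hfin ⟨fun _ => 0, by simp⟩ ?_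
    rintro X hX v hv hB ⟨χ, hχ⟩
    set B := {u | u ∈ X ∧ u ≠ v ∧ H.Adj u v}
    have hBfin : B.Finite := hfin.subset fun u hu => hX hu.1
    obtain ⟨c, -, hc⟩ := Set.exists_mem_notMem_of_ncard_lt_ncard
      (s := χ '' B) (t := Set.univ) (lt_of_le_of_lt (Set.ncard_image_le hBfin)
        (by rw [Set.ncard_univ, Nat.card_fin]; omega)) (hBfin.image _)
    have hnew : ∀ u ∈ X, u ≠ v → H.Adj u v → χ u ≠ c := fun u hu huv h heq =>
      hc ⟨u, ⟨hu, huv, h⟩, heq⟩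
    refine ⟨Function.update χ v c, fun u hu w hw huw h => ?_⟩
    by_cases huv : u = v
    · subst huv
      rw [Function.update_self, Function.update_of_ne huw.symm]
      exact (hnew w hw huw.symm h.symm).symm
    · by_cases hwv : w = v
      · subst hwv
        rw [Function.update_self, Function.update_of_ne huv]
        exact hnew u hu huv h
      · rw [Function.update_of_ne huv, Function.update_of_ne hwv]
        exact hχ u ⟨hu, huv⟩ w ⟨hw, hwv⟩ huw h
  obtain ⟨χ, hχ⟩ := key
  refine ⟨χ, fun e he u hu v hv h => ?_⟩
  by_contra hne
  exact hχ u (he.subset_vertexSet hu) v (he.subset_vertexSet hv) hne ⟨e, he, hu, hv⟩ h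

theorem _root_.Set.Finite.exists_subset_range_fin {α : Type*} {B : Set α} (hB : B.Finite) {d : ℕ}
    (hd : B.ncard ≤ d) (v : α) : ∃ s : Fin d → α, B ⊆ Set.range s := by
  have := hB.fintype
  obtain ⟨f⟩ := Function.Embedding.nonempty_of_card_le (α := B) (β := Fin d)
    (by rwa [Fintype.card_fin, ← Nat.card_eq_fintype_card])
  exact ⟨Function.extend f (↑) fun _ => v, fun b hb => ⟨f ⟨b, hb⟩, f.injective.extend_apply _ _ _⟩⟩

open scoped Classical in
/-- Greedy embedding: the vertices that are not embedded yet are represented by the elements of the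
block of their colour. -/
theorem IsSkeletallyDegenerate.exists_embedding {α β : Type*} {H : Hypergraph α} {d l t : ℕ}
    (hdeg : H.IsSkeletallyDegenerate d) (hfin : V(H).Finite) (ht : 0 < t) (G : Set (Set β))
    (τ : Fin l → Fin t → β) (χ : α → Fin l) (hχ : ∀ e ∈ E(H), Set.InjOn χ e)
    (hmono : ∀ e ∈ E(H), ∀ a : Fin l → Fin t, (fun v => τ (χ v) (a (χ v))) '' e ∈ G)
    (hlarge : HasLargeExtensions G d V(H).ncard τ) :
    ∃ φ : α → β, Set.InjOn φ V(H) ∧ ∀ e ∈ E(H), φ '' e ∈ G := by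
  let ψ : Set α → (α → β) → (Fin l → Fin t) → α → β :=
    fun X φ a u => if u ∈ X then φ u else τ (χ u) (a (χ u))
  -- Invariant: whatever representatives `a` are chosen, each edge becomes an edge of `G`. For `X =
  -- ∅` this is `hmono`.
  have key : ∃ φ : α → β, Set.InjOn φ V(H) ∧ ∀ e ∈ E(H), ∀ a, ψ V(H) φ a '' e ∈ G := by
    refine hdeg.induction (P := fun X => ∃ φ : α → β, Set.InjOn φ X ∧
      ∀ e ∈ E(H), ∀ a, ψ X φ a '' e ∈ G) hfin ?_ ?_
    · rcases isEmpty_or_nonempty β with hβ | ⟨⟨b⟩⟩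
      · have : IsEmpty α := ⟨fun v => hβ.elim (τ (χ v) ⟨0, ht⟩)⟩
        refine ⟨fun v => this.elim v, by simp, fun e he a => ?_⟩
        simpa [ψ] using hmono e he a
      · refine ⟨fun _ => b, by simp, fun e he a => ?_⟩
        simpa [ψ] using hmono e he a
    rintro X hX v hv hB ⟨φ, hφ, hinv⟩
    obtain ⟨s, hs⟩ := (hfin.subset fun u hu => hX hu.1 :
      {u | u ∈ X ∧ u ≠ v ∧ H.Adj u v}.Finite).exists_subset_range_fin hB v
    -- The pattern an edge imposes on `v`: positions in `s` of its embedded vertices and colours of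
    -- its later ones. Padding entries of `s` are filtered out.
    let code : Set α → Set (Fin d ⊕ Fin l) := fun e =>
      Sum.inl '' {p | s p ∈ e ∩ (X \ {v})} ∪ Sum.inr '' (χ '' (e \ X))
    let F : Set (Set (Fin d ⊕ Fin l)) := code '' {e | e ∈ E(H) ∧ v ∈ e}
    have hcode : ∀ e ∈ E(H), v ∈ e → ∀ a : Fin l → Fin t,
        Sum.elim (φ ∘ s) (fun j => τ j (a j)) '' code e = ψ (X \ {v}) φ a '' (e \ {v}) := by
      intro e he hve a
      ext y
      constructor
      · rintro ⟨x, ⟨p, ⟨hpe, hpX⟩, rfl⟩ | ⟨-, ⟨u, hu, rfl⟩, rfl⟩, rfl⟩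
        · exact ⟨s p, ⟨hpe, hpX.2⟩, if_pos hpX⟩
        · refine ⟨u, ⟨hu.1, fun h => hu.2 (h ▸ hv)⟩, ?_⟩
          exact if_neg fun h => hu.2 h.1
      · rintro ⟨u, hu, rfl⟩
        by_cases huX : u ∈ X
        · have huX' : u ∈ X \ {v} := ⟨huX, hu.2⟩
          obtain ⟨p, rfl⟩ := hs ⟨huX, hu.2, e, he, hu.1, hve⟩
          exact ⟨Sum.inl p, Or.inl ⟨p, ⟨hu.1, huX'⟩, rfl⟩,
            (if_pos huX').symm⟩
        · refine ⟨Sum.inr (χ u), Or.inr ⟨_, ⟨u, ⟨hu.1, huX⟩, rfl⟩, rfl⟩, ?_⟩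
          exact (if_neg fun h => huX h.1).symm
    have himage : ∀ (g : α → β) (e : Set α), v ∈ e → g '' e = insert (g v) (g '' (e \ {v})) := by
      intro g e hve
      rw [← Set.image_insert_eq, Set.insert_sdiff_singleton, Set.insert_eq_of_mem hve]
    have hcol : ∀ e ∈ E(H), v ∈ e → ∀ u ∈ e, u ≠ v → χ u ≠ χ v := fun e he hve u hu huv h =>
      huv (hχ e he hu hve h)
    have hW := hlarge (χ v) (φ ∘ s) F ?_ ?_
    · have hXfin := hfin.subset hX
      obtain ⟨w, hw, hwφ⟩ := Set.exists_mem_notMem_of_ncard_lt_ncard (s := φ '' (X \ {v}))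
        (lt_of_lt_of_le (lt_of_le_of_lt (Set.ncard_image_le hXfin.sdiff)
          (lt_of_lt_of_le (Set.ncard_sdiff_singleton_lt_of_mem hv hXfin)
            (Set.ncard_le_ncard hX hfin))) hW) (hXfin.sdiff.image _)
      have hne : ∀ u ∈ X, u ≠ v → φ u ≠ w := fun u hu huv h => hwφ ⟨u, ⟨hu, huv⟩, h⟩
      refine ⟨Function.update φ v w, ?_, fun e he a => ?_⟩
      · intro x hx y hy hxy
        by_cases hxv : x = v <;> by_cases hyv : y = v
        · rw [hxv, hyv]
        · rw [hxv, Function.update_self, Function.update_of_ne hyv] at hxy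
          exact absurd hxy.symm (hne y hy hyv)
        · rw [hyv, Function.update_self, Function.update_of_ne hxv] at hxy
          exact absurd hxy (hne x hx hxv)
        · rw [Function.update_of_ne hxv, Function.update_of_ne hyv] at hxy
          exact hφ ⟨hx, hxv⟩ ⟨hy, hyv⟩ hxy
      · have hold : ∀ u ≠ v, ψ X (Function.update φ v w) a u = ψ (X \ {v}) φ a u := by
          intro u hu
          simp [ψ, hu]
        by_cases hve : v ∈ e
        · rw [himage _ e hve, show ψ X (Function.update φ v w) a v = w by
            simp [ψ, hv],
            Set.image_congr (g := ψ (X \ {v}) φ a) fun u hu => hold u hu.2, ← hcode e he hve a]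
          exact hw _ ⟨e, ⟨he, hve⟩, rfl⟩ a
        · rw [Set.image_congr (g := ψ (X \ {v}) φ a) fun u hu => hold u fun h => hve (h ▸ hu)]
          exact hinv e he a
    · rintro - ⟨e, ⟨he, hve⟩, rfl⟩ (⟨p, -, h⟩ | ⟨-, ⟨u, hu, rfl⟩, h⟩)
      · simp at h
      · exact hcol e he hve u hu.1 (fun h => hu.2 (h ▸ hv)) (Sum.inr_injective h)
    · rintro b - ⟨e, ⟨he, hve⟩, rfl⟩ a
      -- Only `v` has colour `χ v` in `e`, so varying that representative moves only `v`; the whole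
      -- block therefore lies in the extension set.
      have h := hinv e he (Function.update a (χ v) b)
      rw [himage _ e hve, show ψ (X \ {v}) φ (Function.update a (χ v) b) v = τ (χ v) b by
        simp [ψ], Set.image_congr (g := ψ (X \ {v}) φ a) fun u hu => ?_] at h
      · rwa [hcode e he hve a]
      · simp only [ψ]
        rw [Function.update_of_ne (hcol e he hve u hu.1 hu.2)]
  obtain ⟨φ, hφ, h⟩ := key
  refine ⟨φ, hφ, fun e he => ?_⟩
  have := h e he fun _ => ⟨0, ht⟩
  rwa [Set.image_congr (g := φ) fun u hu => if_pos (he.subset_vertexSet hu)]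
    at this

end Hypergraph

/-! ### Quantitative Ramsey bounds -/

namespace Hypergraph

open scoped Classical in
/-- A hypergraph with bounded skeletal degeneracy is contained in any colouring of a complete
hypergraph that is large compared with a Ramsey number of a bounded clique. -/
theorem IsSkeletallyDegenerate.isRamsey {α : Type*} {H : Hypergraph α} {k d q t R N : ℕ}
    (hdeg : H.IsSkeletallyDegenerate d) (hfin : V(H).Finite) (hunif : H.IsUniform k)
    (hq : 0 < q) (ht : 0 < t)
    (hR : ∀ c : Finset ℕ → Fin q, ∃ X ⊆ Finset.range R, X.card = (d + 1) * t ∧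
      ∃ i, ∀ e ⊆ X, e.card = k → c e = i)
    (hN : R ^ 2 * N ^ (R - 1) +
      Fintype.card ((Fin (d + 1) × Fin t ↪ Fin R) × Fin q × Fin (d + 1) ×
        Set (Set (Fin d ⊕ Fin (d + 1)))) * N ^ d * (V(H).ncard ^ t * N ^ (R - t)) < N ^ R) :
    H.IsRamsey k q N := by
  intro c
  obtain ⟨f, hf, hlarge⟩ := exists_injective_hasLargeExtensions (fun i => E(colorClass c i)) hN
  let lift : Finset ℕ → Set (Fin N) := fun e => f '' {x | (x : ℕ) ∈ e}
  -- The default colour is harmless: the sets used below lift to exactly `k` points.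
  obtain ⟨X, hXR, hX, i, hi⟩ := hR fun e =>
    if h : (lift e).ncard = k then c ⟨lift e, h⟩ else ⟨0, hq⟩
  obtain ⟨σ⟩ : Nonempty (Fin (d + 1) × Fin t ≃ X) := ⟨Fintype.equivOfCardEq (by simp [hX])⟩
  let g : Fin (d + 1) × Fin t ↪ Fin R :=
    ⟨fun x => ⟨σ x, Finset.mem_range.mp (hXR (σ x).2)⟩, fun x y h =>
      σ.injective (Subtype.ext (congrArg Fin.val h))⟩
  obtain ⟨χ, hχ⟩ := hdeg.exists_coloring hfin
  suffices hmono : ∀ e ∈ E(H), ∀ a : Fin (d + 1) → Fin t,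
      (fun v => f (g (χ v, a (χ v)))) '' e ∈ E(colorClass c i) by
    obtain ⟨φ, hφ, hφE⟩ := hdeg.exists_embedding hfin ht E(colorClass c i)
      (fun j b => f (g (j, b))) χ hχ hmono (hlarge g i)
    exact ⟨i, φ, hφ, fun _ _ => Set.mem_univ _, hφE⟩
  intro e he a
  have hefin : e.Finite := hfin.subset he.subset_vertexSet
  have hinj : Set.InjOn (fun v => g (χ v, a (χ v))) e := fun u hu v hv h =>
    hχ e he hu hv (congrArg Prod.fst (g.injective h))
  let e' : Finset ℕ := hefin.toFinset.image fun v => (g (χ v, a (χ v)) : ℕ)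
  have hlift : lift e' = (fun v => f (g (χ v, a (χ v)))) '' e := by
    ext y
    simp only [lift, e', Set.mem_image, Set.mem_ofPred_eq, Finset.mem_image,
      Set.Finite.mem_toFinset]
    constructor
    · rintro ⟨x, ⟨v, hv, hvx⟩, rfl⟩
      exact ⟨v, hv, congrArg f (Fin.ext hvx)⟩
    · rintro ⟨v, hv, rfl⟩
      exact ⟨_, ⟨v, hv, rfl⟩, rfl⟩
  have hcard : (lift e').ncard = k := by
    rw [hlift, Set.InjOn.ncard_image fun u hu v hv h => hinj hu hv (hf h), hunif e he]
  have hcol := hi e' ?_ ?_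
  · rw [dif_pos hcard] at hcol
    rw [← hlift]
    exact ⟨hcard, hcol⟩
  · intro x hx
    obtain ⟨v, -, rfl⟩ := Finset.mem_image.mp hx
    exact (σ _).2
  · rw [Finset.card_image_of_injOn fun u hu v hv h => hinj (by simpa using hu) (by simpa using hv)
      (Fin.ext h), ← Set.ncard_eq_toFinset_card e hefin, hunif e he]

theorem _root_.Nat.add_lt_pow_of_two_mul_lt {R C N d n t : ℕ} (hR : 0 < R) (ht : t ≤ R)
    (h₁ : 2 * R ^ 2 < N) (h₂ : 2 * C * n ^ t * N ^ d < N ^ t) :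
    R ^ 2 * N ^ (R - 1) + C * N ^ d * (n ^ t * N ^ (R - t)) < N ^ R := by
  have hN : 0 < N := by omega
  have h₃ : 2 * R ^ 2 * N ^ (R - 1) < N ^ R := by
    calc _ < N * N ^ (R - 1) := Nat.mul_lt_mul_of_pos_right h₁ (by positivity)
      _ = N ^ R := mul_pow_sub_one hR.ne' N
  have h₄ : 2 * C * n ^ t * N ^ d * N ^ (R - t) < N ^ R := by
    calc _ < N ^ t * N ^ (R - t) := Nat.mul_lt_mul_of_pos_right h₂ (by positivity)
      _ = N ^ R := by rw [← pow_add, Nat.add_sub_cancel' ht]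
  linarith

/-- For every block size `t` there is a constant such that a colouring on `N` vertices contains all
`d`-degenerate hypergraphs on `n` vertices once `N ^ t` exceeds the constant times
`n ^ t * N ^ d`. -/
theorem exists_forall_isRamsey (k d q t : ℕ) (hq : 0 < q) (ht : 0 < t) :
    ∃ K : ℕ, 0 < K ∧ ∀ (N n : ℕ), K < N → K * n ^ t * N ^ d < N ^ t →
      ∀ (α : Type*) (H : Hypergraph α), V(H).Finite → V(H).ncard = n → H.IsUniform k →
        H.IsSkeletallyDegenerate d → H.IsRamsey k q N := by
  classical
  obtain ⟨R, hR⟩ := Finset.exists_ramsey q k ((d + 1) * t)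
  have hR' := hR (Finset.range R) (by simp)
  have htR : t ≤ R := by
    obtain ⟨X, hX, hcard, -⟩ := hR' fun _ => ⟨0, hq⟩
    have := Finset.card_le_card hX
    rw [hcard, Finset.card_range] at this
    nlinarith
  set C := Fintype.card ((Fin (d + 1) × Fin t ↪ Fin R) × Fin q × Fin (d + 1) ×
        Set (Set (Fin d ⊕ Fin (d + 1)))) with hC
  refine ⟨2 * R ^ 2 + 2 * C + 1, by omega, fun N n hN hNn α H hfin hn hunif hdeg => ?_⟩
  refine hdeg.isRamsey hfin hunif hq ht hR' ?_
  rw [hn]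
  have := Nat.add_lt_pow_of_two_mul_lt (d := d) (n := n) (N := N) (C := C) (ht.trans_le htR) htR
    (by omega) (lt_of_le_of_lt (by gcongr; omega) hNn)
  convert this

/-- The block size `d + 1` is the least for which `N ^ t` outgrows `N ^ d`; this crude bound covers
small `n`. -/
theorem exists_isRamsey (k d q n : ℕ) (hq : 0 < q) :
    ∃ N : ℕ, 0 < N ∧ ∀ (α : Type*) (H : Hypergraph α), V(H).Finite → V(H).ncard = n →
      H.IsUniform k → H.IsSkeletallyDegenerate d → H.IsRamsey k q N := by
  obtain ⟨K, hK, h⟩ := exists_forall_isRamsey k d q (d + 1) hq (by omega)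
  refine ⟨K * n ^ (d + 1) + K + 1, by omega, h _ n (by omega) ?_⟩
  rw [pow_succ' (K * n ^ (d + 1) + K + 1) d]
  exact Nat.mul_lt_mul_of_pos_right (by omega) (by positivity)

theorem eventually_exists_isRamsey_le_rpow (k d q : ℕ) (hq : 0 < q) {ε : ℝ}
    (hε : 0 < ε) :
    ∀ᶠ n : ℕ in atTop, ∃ N : ℕ, 0 < N ∧ (N : ℝ) ≤ (n : ℝ) ^ (1 + ε) ∧
      ∀ (α : Type*) (H : Hypergraph α), V(H).Finite → V(H).ncard = n →
        H.IsUniform k → H.IsSkeletallyDegenerate d → H.IsRamsey k q N := by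
  -- One `δ` is for the embedding; the other absorbs rounding up, as `n ^ δ ≥ 2`.
  obtain ⟨δ, hδ, rfl⟩ : ∃ δ : ℝ, 0 < δ ∧ ε = 2 * δ := ⟨ε / 2, by positivity, by ring⟩
  -- This is `t / (1 + δ) + d + 1 ≤ t`, where the extra `1` pays for `K < N`.
  obtain ⟨t, ht⟩ := exists_nat_ge (((d : ℝ) + 1) * (1 + δ) / δ)
  have htpos : 0 < t := by
    have : 0 < ((d : ℝ) + 1) * (1 + δ) / δ := by positivity
    exact_mod_cast this.trans_le ht
  obtain ⟨K, hK, h⟩ := exists_forall_isRamsey k d q t hq htpos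
  have hlim := (tendsto_rpow_atTop hδ).comp (tendsto_natCast_atTop_atTop (R := ℝ))
  filter_upwards [eventually_gt_atTop K, hlim.eventually_ge_atTop 2] with n hn hn2
  have hn2 : (2 : ℝ) ≤ (n : ℝ) ^ δ := hn2
  have hn1 : (1 : ℝ) ≤ n := by exact_mod_cast (by omega : 1 ≤ n)
  have hn0 : (0 : ℝ) < n := by linarith
  set N := ⌈(n : ℝ) ^ (1 + δ)⌉₊ with hN
  have hle : (n : ℝ) ^ (1 + δ) ≤ N := Nat.le_ceil _
  have hone : (1 : ℝ) ≤ (n : ℝ) ^ (1 + δ) := Real.one_le_rpow hn1 (by linarith)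
  have hnN : (n : ℝ) ≤ N := by
    calc (n : ℝ) = (n : ℝ) ^ (1 : ℝ) := (Real.rpow_one _).symm
      _ ≤ (n : ℝ) ^ (1 + δ) := Real.rpow_le_rpow_of_exponent_le hn1 (by linarith)
      _ ≤ N := hle
  have hKN : K < N := lt_of_lt_of_le hn (by exact_mod_cast hnN)
  have hN1 : (1 : ℝ) ≤ N := hn1.trans hnN
  have hN0 : (0 : ℝ) < N := by linarith
  refine ⟨N, by omega, ?_, h N n hKN ?_⟩
  · calc (N : ℝ) ≤ (n : ℝ) ^ (1 + δ) + 1 := (Nat.ceil_lt_add_one (by positivity)).le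
      _ ≤ (n : ℝ) ^ (1 + δ) * (n : ℝ) ^ δ := by nlinarith
      _ = (n : ℝ) ^ (1 + 2 * δ) := by rw [← Real.rpow_add hn0]; ring_nf
  · have hroot : (n : ℝ) ≤ (N : ℝ) ^ (1 / (1 + δ)) := by
      calc (n : ℝ) = ((n : ℝ) ^ (1 + δ)) ^ (1 / (1 + δ)) := by
            rw [← Real.rpow_mul hn0.le, mul_one_div_cancel (by positivity), Real.rpow_one]
        _ ≤ _ := Real.rpow_le_rpow (by positivity) hle (by positivity)
    have hexp : 1 + (1 / (1 + δ) * t + d) ≤ (t : ℝ) := by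
      have h1 : ((d : ℝ) + 1) * (1 + δ) ≤ t * δ := (div_le_iff₀ hδ).mp ht
      have h2 : (t : ℝ) - 1 / (1 + δ) * t = t * δ / (1 + δ) := by field_simp; ring
      have h3 : (d : ℝ) + 1 ≤ t * δ / (1 + δ) := (le_div_iff₀ (by positivity)).mpr h1
      linarith
    have hfinal : (K : ℝ) * n ^ t * N ^ d < N ^ t := by
      calc (K : ℝ) * n ^ t * N ^ d
          ≤ K * (N : ℝ) ^ (1 / (1 + δ) * t) * N ^ d := by
            rw [Real.rpow_mul_natCast hN0.le]
            gcongr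
        _ < N * (N : ℝ) ^ (1 / (1 + δ) * t) * N ^ d := by
            have : (K : ℝ) < N := by exact_mod_cast hKN
            gcongr
        _ = (N : ℝ) ^ (1 + (1 / (1 + δ) * t + d)) := by
            rw [Real.rpow_add hN0, Real.rpow_add hN0, Real.rpow_one, Real.rpow_natCast, mul_assoc]
        _ ≤ (N : ℝ) ^ (t : ℝ) := Real.rpow_le_rpow_of_exponent_le hN1 hexp
        _ = (N : ℝ) ^ t := Real.rpow_natCast _ _
    exact_mod_cast hfinal

end Hypergraph

/-! ### The error function -/

open Hypergraph in
theorem theorem4p1 (k d q : ℕ) (hk : 2 ≤ k) (hd : 2 ≤ d) (hq : 2 ≤ q) :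
    ∃ o : ℕ → ℝ, Tendsto o atTop (𝓝 0) ∧
      ∀ (α : Type*) (H : Hypergraph α) (n : ℕ),
        V(H).Finite → V(H).ncard = n → H.IsUniform k → H.skeletalDegeneracy = d →
          (∃ N : ℕ, 0 < N ∧ H.IsRamsey k q N) ∧
            (H.ramseyNumber k q : ℝ) ≤ (n : ℝ) ^ (1 + o n) := by
  let good : ℕ → Set ℕ := fun n => {N | 0 < N ∧ ∀ (α : Type _) (H : Hypergraph α), V(H).Finite →
    V(H).ncard = n → H.IsUniform k → H.IsSkeletallyDegenerate d → H.IsRamsey k q N}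
  -- `M n` serves all `H` on `n` vertices at once, so `o` does not depend on `H`.
  let M : ℕ → ℕ := fun n => sInf (good n)
  have hM : ∀ n, M n ∈ good n := fun n =>
    Nat.sInf_mem (exists_isRamsey k d q n (by omega))
  -- With the maximum, convergence needs only an upper bound on `M n`.
  refine ⟨fun n => max 0 (Real.log (M n) / Real.log n - 1), ?_, ?_⟩
  · rw [Metric.tendsto_nhds]
    intro ε hε
    filter_upwards [eventually_exists_isRamsey_le_rpow k d q (by omega) (half_pos hε),
      eventually_ge_atTop 2] with n ⟨N, hN, hle, hgood⟩ hn
    have hn1 : (1 : ℝ) < n := by exact_mod_cast hn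
    have hlog : 0 < Real.log n := Real.log_pos hn1
    have hMN : M n ≤ N := Nat.sInf_le ⟨hN, hgood⟩
    have hM0 : (0 : ℝ) < M n := by exact_mod_cast (hM n).1
    have hbound : Real.log (M n) ≤ (1 + ε / 2) * Real.log n := by
      rw [← Real.log_rpow (by linarith)]
      exact Real.log_le_log hM0 (le_trans (by exact_mod_cast hMN) hle)
    have hdiv := (div_le_iff₀ hlog).mpr hbound
    rw [Real.dist_eq, sub_zero, abs_of_nonneg (le_max_left _ _)]
    exact max_lt hε (by linarith)
  · intro α H n hfin hn hunif hskel
    have hpos : 0 < H.skeletalDegeneracy := by omega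
    have hdeg : H.IsSkeletallyDegenerate d := hskel ▸
      isSkeletallyDegenerate_skeletalDegeneracy hfin hpos
    have hram : 0 < M n ∧ H.IsRamsey k q (M n) := ⟨(hM n).1, (hM n).2 α H hfin hn hunif hdeg⟩
    refine ⟨⟨M n, hram⟩, ?_⟩
    have hn1 : (1 : ℝ) < n := by
      exact_mod_cast hn ▸ two_le_ncard_of_skeletalDegeneracy_pos hfin hpos
    have hM0 : (0 : ℝ) < M n := by exact_mod_cast hram.1
    calc (H.ramseyNumber k q : ℝ) ≤ M n := by exact_mod_cast Nat.sInf_le hram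
      _ = (n : ℝ) ^ (Real.log (M n) / Real.log n) := by
        rw [Real.rpow_def_of_pos (by linarith), mul_div_cancel₀ _ (Real.log_pos hn1).ne',
          Real.exp_log hM0]
      _ ≤ _ := Real.rpow_le_rpow_of_exponent_le hn1.le
        (by linarith [le_max_right 0 (Real.log (M n) / Real.log n - 1)])
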